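/- Let $P$ be a set of $n$ points in general position in ${\mathbb R}^2$ (that is, no three points of $P$ are collinear), and let $D(P)$ be the edge disjointness graph of $P$: its vertices are the $\binom{n}{2}$ closed straight line segments joining two distinct points of $P$, and two such segments are adjacent in $D(P)$ if and only if they are disjoint. If $n\geq 9$, then $D(P)$ is hamiltonian, i.e. it contains a cycle passing through every vertex of $D(P)$. -/

import Mathlib

/-- The Euclidean plane. -/
abbrev Plane : Type := EuclideanSpace ℝ (Fin 2)

/-- A finite set of points of the plane is in general position if no three distinct points of it
are collinear. -/
def InGeneralPosition (P : Finset Plane) : Prop :=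
  ∀ a ∈ P, ∀ b ∈ P, ∀ c ∈ P, a ≠ b → a ≠ c → b ≠ c → ¬ Collinear ℝ ({a, b, c} : Set Plane)

/-- The set of all segments of `P`: the closed straight line segments, as subsets of the plane,
whose endpoints are two distinct points of `P`. -/
def segmentsOf (P : Finset Plane) : Set (Set Plane) :=
  {s | ∃ x ∈ P, ∃ y ∈ P, x ≠ y ∧ s = segment ℝ x y}

noncomputable instance segmentsOf_decidableEq (P : Finset Plane) : DecidableEq (segmentsOf P) :=
  Classical.decEq _

/-- The edge disjointness graph of `P`: its vertices are the segments of `P`, and two of them are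
adjacent if and only if they are disjoint. -/
def disjointnessGraph (P : Finset Plane) : SimpleGraph (segmentsOf P) where
  Adj s t := Disjoint (s : Set Plane) (t : Set Plane)
  symm := ⟨fun _ _ h => Disjoint.symm h⟩
  loopless := ⟨by
    rintro ⟨s, x, hx, y, hy, hxy, rfl⟩ h
    exact Set.disjoint_left.mp h (left_mem_segment ℝ x y) (left_mem_segment ℝ x y)⟩

/-! By Chvátal–Erdős, a finite graph with a cycle is hamiltonian once no independent set is larger
than any cut. Both quantities are compared with n = |P|. Independent sets of D(P) are families of
pairwise intersecting segments, which have at most n members (`card_le_of_pairwise_intersecting`).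
It remains to see that cuts have at least n vertices (`cutBound_le_card_uncolored`).

Regard the two sides of a cut as colours B and R, so that every B-segment meets every R-segment; the
cut consists of the uncoloured pairs. Induct by deleting a point. In a counterexample each coloured
pair is disjoint from another of its colour, so both colours survive the deletion of any point, and
induction leaves at most d uncoloured pairs at each point, where d ≤ 2 and d = 2 only for nine
points. A crossing argument with cevians shows that a coloured pair has at most 2d + 2 points on
either side (`card_leftOf_le`). Hull edges are therefore uncoloured; a hull vertex lies on two of
them, so d = 2. For nine points, a pair at that vertex with six points on one side must then be
coloured, and `card_leftOf_lt_of_mem_missing` rules this out. -/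

namespace SimpleGraph

/-! ### Cycles as lists and the Chvátal–Erdős theorem. -/

variable {V : Type*} {G : SimpleGraph V}

/-- A list is a cycle of `G` if its members are distinct, consecutive ones are adjacent, and the last
is adjacent to the first. -/
structure IsCycleList (G : SimpleGraph V) (l : List V) : Prop where
  three_le : 3 ≤ l.length
  nodup : l.Nodup
  chain : Cycle.Chain G.Adj (l : Cycle V)

theorem cycleChain_iff {l : List V} :
    Cycle.Chain G.Adj (l : Cycle V) ↔
      l.IsChain G.Adj ∧ ∀ x ∈ l.getLast?, ∀ y ∈ l.head?, G.Adj x y := by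
  cases l with
  | nil => simp
  | cons a l =>
    rw [Cycle.chain_coe_cons, ← List.cons_append, List.isChain_append]
    simp

theorem isCycleList_triple {a b c : V} (h1 : G.Adj a b) (h2 : G.Adj b c) (h3 : G.Adj c a) :
    G.IsCycleList [a, b, c] where
  three_le := by simp
  nodup := by simp [h1.ne, h2.ne, h3.ne.symm]
  chain := cycleChain_iff.2 (by simp [h1, h2, h3])

theorem IsCycleList.of_isRotated {l l' : List V} (h : G.IsCycleList l) (hr : l ~r l') :
    G.IsCycleList l' where
  three_le := hr.perm.length_eq ▸ h.three_le
  nodup := hr.nodup_iff.1 h.nodup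
  chain := by
    rw [← Cycle.coe_eq_coe.2 hr]
    exact h.chain

/-- `l.formPerm` is the successor map of the cycle. The rotation makes the edge from `s` to its
successor the closing edge, where `IsCycleList.append` can open it. -/
theorem exists_isRotated_cons_append_formPerm [DecidableEq V] {l : List V} (hl : l.Nodup)
    (h2 : 2 ≤ l.length) {s : V} (hs : s ∈ l) :
    ∃ m, l ~r (l.formPerm s :: m ++ [s]) := by
  obtain ⟨u, w, rfl⟩ := List.append_of_mem hs
  have hr : (u ++ s :: w) ~r (w ++ u ++ [s]) := by
    have := List.isRotated_append (l := u ++ [s]) (l' := w)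
    simpa using this
  rw [List.formPerm_eq_of_isRotated hl hr]
  obtain ⟨t, m, htm⟩ : ∃ t m, w ++ u = t :: m := by
    cases h : w ++ u with
    | nil => simp at h; simp [h.1, h.2] at h2
    | cons t m => exact ⟨t, m, rfl⟩
  rw [htm] at hr ⊢
  refine ⟨m, ?_⟩
  have h : (t :: m ++ [s]).formPerm s = t := List.formPerm_cons_concat_apply_last t s m
  rw [h]
  exact hr

/-- Replacing the edge between the end and the beginning of a cycle by a path. -/
theorem IsCycleList.append {l q : List V} {a t x y : V} (hl : G.IsCycleList l)
    (ha : l.getLast? = some a) (ht : l.head? = some t) (hq : q.IsChain G.Adj) (hqn : q.Nodup)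
    (hd : l.Disjoint q) (hx : q.head? = some x) (hy : q.getLast? = some y)
    (hax : G.Adj a x) (hyt : G.Adj y t) : G.IsCycleList (l ++ q) where
  three_le := by have := hl.three_le; simp; omega
  nodup := hl.nodup.append hqn hd
  chain := by
    obtain ⟨h1, h2⟩ := cycleChain_iff.1 hl.chain
    refine cycleChain_iff.2 ⟨List.isChain_append.2 ⟨h1, hq, ?_⟩, ?_⟩
    · simp [ha, hx, hax]
    · simp [List.getLast?_append, List.head?_append, ht, hy, hyt]

/-- Two edges `b b'` and `a t` of a cycle, where `t` is its beginning and `a` its end, are replaced by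
the edge `b' t` and a path from `b` to `a`. -/
theorem IsCycleList.reroute {u r q : List V} {a b b' t x y : V} (hl : G.IsCycleList (u ++ r))
    (hb : u.getLast? = some b) (hb' : r.head? = some b')
    (ha : r.getLast? = some a) (ht : u.head? = some t) (hq : q.IsChain G.Adj) (hqn : q.Nodup)
    (hd : (u ++ r).Disjoint q) (hx : q.head? = some x) (hy : q.getLast? = some y)
    (hbx : G.Adj b x) (hya : G.Adj y a) (hbt : G.Adj b' t) :
    G.IsCycleList (u ++ (q ++ r.reverse)) where
  three_le := by have := hl.three_le; simp at *; omega
  nodup := by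
    have h := hl.nodup.append hqn hd
    refine (List.Perm.nodup_iff ?_).1 h
    rw [List.append_assoc]
    refine List.Perm.append_left _ (List.perm_append_comm.trans ?_)
    exact List.Perm.append_left _ (List.reverse_perm r).symm
  chain := by
    obtain ⟨h1, h2⟩ := cycleChain_iff.1 hl.chain
    obtain ⟨hu, hr, -⟩ := List.isChain_append.1 h1
    have hr' : r.reverse.IsChain G.Adj := by
      rw [List.isChain_reverse]
      exact hr.imp fun _ _ h => h.symm
    refine cycleChain_iff.2 ⟨List.isChain_append.2 ⟨hu, List.isChain_append.2 ⟨hq, hr', ?_⟩, ?_⟩, ?_⟩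
    · simp [ha, hy, hya]
    · simp [List.head?_append, hb, hx, hbx]
    · simp [List.getLast?_append, List.head?_append, ht, hb', hbt]

theorem IsCycleList.exists_isHamiltonianCycle [DecidableEq V] {l : List V} (hl : G.IsCycleList l)
    (hall : ∀ v, v ∈ l) : ∃ (s : V) (C : G.Walk s s), C.IsHamiltonianCycle := by
  obtain ⟨h1, h2⟩ := cycleChain_iff.1 hl.chain
  have hne : l ≠ [] := by rintro rfl; simpa using hl.three_le
  let p := Walk.ofSupport l hne h1
  have hsup : p.support = l := Walk.support_ofSupport hne h1
  have hp : p.IsPath := Walk.IsPath.mk' (hsup.symm ▸ hl.nodup)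
  have hlen : p.length = l.length - 1 := Walk.length_ofSupport hne h1
  have hadj : G.Adj (l.getLast hne) (l.head hne) :=
    h2 _ (List.getLast?_eq_some_getLast hne) _ (List.head?_eq_some_head hne)
  refine ⟨_, Walk.cons hadj p, ?_, ?_⟩
  · have h3 := hl.three_le
    rw [Walk.isCycle_iff_isPath_tail_and_le_length]
    exact ⟨by simpa using hp, by simp [hlen]; omega⟩
  · have : (Walk.cons hadj p).tail.IsPath := by simpa using hp
    refine this.isHamiltonian_of_mem fun w => ?_
    simp [hsup, hall]

theorem exists_path_of_reachable_induce {U : Set V} {x y : U} (h : (G.induce U).Reachable x y) :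
    ∃ q : List V, q.IsChain G.Adj ∧ q.Nodup ∧ (∀ z ∈ q, z ∈ U) ∧ q.head? = some x.1 ∧
      q.getLast? = some y.1 := by
  obtain ⟨p, hp⟩ := h.exists_isPath
  refine ⟨p.support.map Subtype.val, ?_, ?_, ?_, ?_, ?_⟩
  · rw [List.isChain_map]
    exact p.isChain_adj_support.imp fun _ _ h => h
  · exact hp.support_nodup.map Subtype.val_injective
  · rintro _ hz
    obtain ⟨z, -, rfl⟩ := List.mem_map.1 hz
    exact z.2
  · rw [List.head?_map, List.head?_eq_some_head p.support_ne_nil, p.head_support]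
    rfl
  · rw [List.getLast?_map, List.getLast?_eq_some_getLast p.support_ne_nil, p.getLast_support]
    rfl

/-- The **Chvátal–Erdős theorem**, for a graph with a cycle: a finite graph in which every cut has at
least as many vertices as every independent set is hamiltonian. -/
theorem exists_isHamiltonianCycle_of_indep_le_cut [Fintype V] [DecidableEq V] (k : ℕ)
    (hcyc : ∃ l, G.IsCycleList l)
    (hindep : ∀ I : Finset V, (∀ x ∈ I, ∀ y ∈ I, ¬ G.Adj x y) → I.card ≤ k)
    (hcut : ∀ (A B : Set V) (S : Finset V), A.Nonempty → B.Nonempty →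
      (∀ v, v ∈ A ∨ v ∈ B ∨ v ∈ S) → (∀ a ∈ A, ∀ b ∈ B, ¬ G.Adj a b) → k ≤ S.card) :
    ∃ (s : V) (C : G.Walk s s), C.IsHamiltonianCycle := by
  classical
  obtain ⟨l, hl, hmax⟩ : ∃ l, G.IsCycleList l ∧ ∀ l', G.IsCycleList l' → l'.length ≤ l.length := by
    have hbd : ∀ n, (∃ l, G.IsCycleList l ∧ l.length = n) → n ≤ Fintype.card V := by
      rintro n ⟨l, hl, rfl⟩
      exact hl.nodup.length_le_card
    obtain ⟨l₀, hl₀⟩ := hcyc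
    obtain ⟨l, hl, hln⟩ := Nat.findGreatest_spec (P := fun n => ∃ l, G.IsCycleList l ∧ l.length = n)
      (hbd _ ⟨l₀, hl₀, rfl⟩) ⟨l₀, hl₀, rfl⟩
    exact ⟨l, hl, fun l' hl' =>
      hln ▸ Nat.le_findGreatest (hbd _ ⟨l', hl', rfl⟩) ⟨l', hl', rfl⟩⟩
  by_cases hall : ∀ v, v ∈ l
  · exact hl.exists_isHamiltonianCycle hall
  exfalso
  obtain ⟨x, hx⟩ := not_forall.1 hall
  let U : Set V := {v | v ∉ l}
  -- `A` is the component of `x` off the longest cycle; `S` below collects its neighbours on the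
  -- cycle.
  let A : Set V := {v | ∃ h : v ∈ U, (G.induce U).Reachable ⟨x, hx⟩ ⟨v, h⟩}
  have hxA : x ∈ A := ⟨hx, Reachable.refl _⟩
  have hAl : ∀ v ∈ A, v ∉ l := fun v ⟨h, _⟩ => h
  have hpath : ∀ v ∈ A, ∀ w ∈ A, ∃ q : List V, q.IsChain G.Adj ∧ q.Nodup ∧ (∀ z ∈ q, z ∉ l) ∧
      q.head? = some v ∧ q.getLast? = some w := by
    rintro v ⟨hv, hv'⟩ w ⟨hw, hw'⟩
    exact exists_path_of_reachable_induce (hv'.symm.trans hw')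
  have hclosed : ∀ v ∈ A, ∀ w, w ∉ l → G.Adj v w → w ∈ A := by
    rintro v ⟨hv, hv'⟩ w hw hvw
    exact ⟨hw, hv'.trans (Adj.reachable (by simpa using hvw))⟩
  let S : Finset V := l.toFinset.filter fun s => ∃ v ∈ A, G.Adj s v
  have hsucc : ∀ s ∈ S, ∃ m, l ~r (l.formPerm s :: m ++ [s]) := fun s hs =>
    exists_isRotated_cons_append_formPerm hl.nodup (by have := hl.three_le; omega)
      (by simpa [S] using (Finset.mem_filter.1 hs).1)
  -- Otherwise a path through `A` inserted between `s` and its successor would lengthen the cycle.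
  have hnot : ∀ s ∈ S, ∀ w ∈ A, ¬ G.Adj w (l.formPerm s) := by
    intro s hs w hw hadj
    obtain ⟨m, hm⟩ := hsucc s hs
    obtain ⟨v, hv, hsv⟩ := (Finset.mem_filter.1 hs).2
    obtain ⟨q, hq, hqn, hql, hqh, hqe⟩ := hpath v hv w hw
    have hlong := (hl.of_isRotated hm).append (q := q) (a := s) (t := l.formPerm s)
      List.getLast?_concat rfl hq hqn (fun z hz hz' => hql z hz' (hm.mem_iff.2 hz)) hqh hqe hsv hadj
    have h1 := hmax _ hlong
    have h2 := hm.perm.length_eq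
    have h3 : 0 < q.length := List.length_pos_of_mem (List.mem_of_head? hqh)
    simp only [List.length_append] at h1 h2
    omega
  -- Two adjacent successors would allow a longer cycle: go from `b` to `a` through `A`, traverse
  -- one arc backwards, and close up along the edge between the successors.
  have hSS : ∀ a ∈ S, ∀ b ∈ S, ¬ G.Adj (l.formPerm a) (l.formPerm b) := by
    intro a ha b hb hadj
    have hab : a ≠ b := by rintro rfl; exact G.loopless.irrefl _ hadj
    obtain ⟨m, hm⟩ := hsucc a ha
    have hb' : b ∈ l.formPerm a :: m := by
      have : b ∈ l := by simpa using (Finset.mem_filter.1 hb).1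
      have := hm.mem_iff.1 this
      simp only [List.cons_append, List.mem_cons, List.mem_append, List.mem_nil_iff, or_false]
        at this ⊢
      tauto
    obtain ⟨u, w, huw⟩ := List.append_of_mem hb'
    obtain ⟨c, r, hcr⟩ : ∃ c r, w ++ [a] = c :: r := by
      cases w <;> simp
    have hl' : l ~r ((u ++ [b]) ++ (c :: r)) := by
      rw [huw] at hm
      simpa [hcr] using hm
    have hcb : l.formPerm b = c := by
      rw [List.formPerm_eq_of_isRotated hl.nodup hl']
      have hn := (hl.of_isRotated hl').nodup
      have := List.formPerm_apply_lt_getElem _ hn u.length (by simp)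
      simpa using this
    obtain ⟨v, hv, hav⟩ := (Finset.mem_filter.1 ha).2
    obtain ⟨v', hv', hbv⟩ := (Finset.mem_filter.1 hb).2
    obtain ⟨q, hq, hqn, hql, hqh, hqe⟩ := hpath v' hv' v hv
    have hlong := (hl.of_isRotated hl').reroute (q := q) (a := a) (b := b) (b' := c)
      (t := l.formPerm a) (by simp) (by simp) (by rw [← hcr]; simp)
      (by
        have : (u ++ b :: w).head? = some (l.formPerm a) := by rw [← huw]; rfl
        cases u <;> simpa using this)
      hq hqn (fun z hz hz' => hql z hz' (hl'.mem_iff.2 hz)) hqh hqe hbv hav.symm (hcb ▸ hadj.symm)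
    have h1 := hmax _ hlong
    have h2 := hl'.perm.length_eq
    have h3 : 0 < q.length := List.length_pos_of_mem (List.mem_of_head? hqh)
    simp only [List.length_append, List.length_reverse] at h1 h2
    omega
  have hS : k ≤ S.card := by
    refine hcut A {v | v ∉ A ∧ v ∉ S} S ⟨x, hxA⟩ ?_ (fun v => ?_) ?_
    -- The far side of the cut is not empty: it contains the successor of any member of `S`, or any
    -- cycle vertex if `S` is empty.
    · by_cases hSe : S.Nonempty
      · obtain ⟨s, hs⟩ := hSe
        have hsl : l.formPerm s ∈ l :=
          List.formPerm_apply_mem_of_mem (by simpa using (Finset.mem_filter.1 hs).1)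
        refine ⟨l.formPerm s, fun h => hAl _ h hsl, fun h => ?_⟩
        obtain ⟨v, hv, hsv⟩ := (Finset.mem_filter.1 h).2
        exact hnot s hs v hv hsv.symm
      · have h3 := hl.three_le
        obtain ⟨y, hy⟩ := List.exists_mem_of_length_pos (by omega : 0 < l.length)
        exact ⟨y, fun h => hAl _ h hy, fun h => hSe ⟨y, h⟩⟩
    · by_cases h : v ∈ A <;> by_cases h' : v ∈ S <;> simp [h, h']
    · rintro a ha b ⟨hbA, hbS⟩ hab
      by_cases hbl : b ∈ l
      · exact hbS (Finset.mem_filter.2 ⟨by simpa using hbl, a, ha, hab.symm⟩)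
      · exact hbA (hclosed a ha b hbl hab)
  -- The successors of `S` together with `x` form an independent set of |S| + 1 > k vertices.
  have hI := hindep (insert x (S.map l.formPerm.toEmbedding)) (by
    have hx1 : ∀ s ∈ S, ¬ G.Adj x (l.formPerm s) := fun s hs => hnot s hs x hxA
    simp only [Finset.mem_insert, Finset.mem_map, Equiv.toEmbedding_apply]
    rintro _ (rfl | ⟨a, ha, rfl⟩) _ (rfl | ⟨b, hb, rfl⟩)
    · exact G.loopless.irrefl _
    · exact hx1 b hb
    · exact fun h => hx1 a ha h.symm
    · exact hSS a ha b hb)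
  rw [Finset.card_insert_of_notMem, Finset.card_map] at hI
  · omega
  · simp only [Finset.mem_map, Equiv.toEmbedding_apply, not_exists, not_and]
    rintro s hs rfl
    exact hx (List.formPerm_apply_mem_of_mem (by simpa using (Finset.mem_filter.1 hs).1))

end SimpleGraph

/-! ### Orientation and disjointness of segments. -/

/-- Twice the signed area of the triangle `a b c`. -/
def orient (a b c : Plane) : ℝ := (b 0 - a 0) * (c 1 - a 1) - (b 1 - a 1) * (c 0 - a 0)

theorem orient_swap_left (a b c : Plane) : orient b a c = -orient a b c := by
  unfold orient; ring

theorem orient_swap_right (a b c : Plane) : orient a c b = -orient a b c := by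
  unfold orient; ring

@[simp] theorem orient_self_left (a b : Plane) : orient a b a = 0 := by
  unfold orient; ring

@[simp] theorem orient_self_right (a b : Plane) : orient a b b = 0 := by
  unfold orient; ring

theorem orient_combo (a b c d : Plane) {s t : ℝ} (hst : s + t = 1) :
    orient a b (s • c + t • d) = s * orient a b c + t * orient a b d := by
  obtain rfl : s = 1 - t := by linarith
  simp only [orient, PiLp.add_apply, PiLp.smul_apply, smul_eq_mul]
  ring

theorem collinear_of_orient_eq_zero {a b c : Plane} (hab : a ≠ b) (h : orient a b c = 0) :
    Collinear ℝ ({a, b, c} : Set Plane) := by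
  rw [collinear_iff_of_mem (p₀ := a) (by simp)]
  have hne : b 0 - a 0 ≠ 0 ∨ b 1 - a 1 ≠ 0 := by
    by_contra! hcon
    apply hab
    ext i
    fin_cases i
    · simpa using (sub_eq_zero.1 hcon.1).symm
    · simpa using (sub_eq_zero.1 hcon.2).symm
  unfold orient at h
  refine ⟨b - a, ?_⟩
  simp only [Set.mem_insert_iff, Set.mem_singleton_iff, forall_eq_or_imp, forall_eq]
  refine ⟨⟨0, by simp⟩, ⟨1, by simp⟩, ?_⟩
  rcases hne with hne | hne
  · refine ⟨(c 0 - a 0) / (b 0 - a 0), ?_⟩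
    ext i
    fin_cases i
    · simp [div_mul_cancel₀ _ hne]
    · simp
      field_simp
      linarith
  · refine ⟨(c 1 - a 1) / (b 1 - a 1), ?_⟩
    ext i
    fin_cases i
    · simp
      field_simp
      linarith
    · simp [div_mul_cancel₀ _ hne]

theorem InGeneralPosition.orient_ne_zero {T : Finset Plane} (hT : InGeneralPosition T) {a b c : Plane}
    (ha : a ∈ T) (hb : b ∈ T) (hc : c ∈ T) (hab : a ≠ b) (hac : a ≠ c) (hbc : b ≠ c) :
    orient a b c ≠ 0 :=
  fun h => hT a ha b hb c hc hab hac hbc (collinear_of_orient_eq_zero hab h)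

theorem InGeneralPosition.mono {T T' : Finset Plane} (hT : InGeneralPosition T) (h : T' ⊆ T) :
    InGeneralPosition T' :=
  fun a ha b hb c hc => hT a (h ha) b (h hb) c (h hc)

/-- A line separates the two segments. Only one side needs to be strict, so `c d` may be `a b`
itself. -/
theorem disjoint_segment_of_orient {a b c d e f : Plane} (hc : orient a b c ≤ 0)
    (hd : orient a b d ≤ 0) (he : 0 < orient a b e) (hf : 0 < orient a b f) :
    Disjoint (segment ℝ c d) (segment ℝ e f) := by
  rw [Set.disjoint_left]
  rintro z ⟨s, t, hs, ht, hst, rfl⟩ ⟨s', t', hs', ht', hst', hz⟩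
  have h := congrArg (orient a b) hz
  rw [orient_combo _ _ _ _ hst, orient_combo _ _ _ _ hst'] at h
  have h1 : s * orient a b c + t * orient a b d ≤ 0 := by nlinarith
  rcases hs'.lt_or_eq with h2 | h2
  · nlinarith [mul_pos h2 he, mul_nonneg ht' hf.le]
  · subst h2
    obtain rfl : t' = 1 := by linarith
    nlinarith

theorem disjoint_segment_of_mul_orient_pos {a b c d : Plane} (h : 0 < orient a b c * orient a b d) :
    Disjoint (segment ℝ a b) (segment ℝ c d) := by
  rcases pos_and_pos_or_neg_and_neg_of_mul_pos h with ⟨h1, h2⟩ | ⟨h1, h2⟩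
  · exact disjoint_segment_of_orient (a := a) (b := b) (by simp) (by simp) h1 h2
  · refine disjoint_segment_of_orient (a := b) (b := a) (by simp) (by simp) ?_ ?_ <;>
      rw [orient_swap_left] <;> linarith

/-- The segments lie on different sides of the line `a b` and touch it only at `a` and `b`
respectively. -/
theorem disjoint_segment_of_opposite {a b c d : Plane} (hc : orient a b c < 0)
    (hd : 0 < orient a b d) : Disjoint (segment ℝ a c) (segment ℝ b d) := by
  rw [Set.disjoint_left]
  rintro z ⟨s, t, hs, ht, hst, rfl⟩ ⟨s', t', hs', ht', hst', hz⟩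
  have h := congrArg (orient a b) hz
  rw [orient_combo _ _ _ _ hst, orient_combo _ _ _ _ hst'] at h
  simp only [orient_self_left, orient_self_right, mul_zero, zero_add] at h
  have h1 : t' = 0 := by
    by_contra h0
    nlinarith [mul_pos (ht'.lt_of_ne' h0) hd]
  have h2 : t = 0 := by
    by_contra h0
    nlinarith [mul_pos (ht.lt_of_ne' h0) (neg_pos.2 hc)]
  subst h1 h2
  obtain rfl : s = 1 := by linarith
  obtain rfl : s' = 1 := by linarith
  simp only [one_smul, zero_smul, add_zero] at hz
  subst hz
  simp [orient] at hd

/-- Two cevians of a triangle `x y z` meet. -/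
theorem segment_inter_nonempty_of_cevians {E : Type*} [AddCommGroup E] [Module ℝ E]
    {x y z α β : E} (h1 : ¬ Disjoint (segment ℝ x z) (segment ℝ β y))
    (h2 : ¬ Disjoint (segment ℝ y z) (segment ℝ α x)) :
    ¬ Disjoint (segment ℝ α x) (segment ℝ β y) := by
  obtain ⟨u, hu, huβ⟩ := Set.not_disjoint_iff.1 h1
  obtain ⟨w, hw, hwα⟩ := Set.not_disjoint_iff.1 h2
  have hyu : segment ℝ y u ⊆ segment ℝ β y :=
    (convex_segment β y).segment_subset (right_mem_segment ℝ β y) huβ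
  have hxw : segment ℝ x w ⊆ segment ℝ α x :=
    (convex_segment α x).segment_subset (right_mem_segment ℝ α x) hwα
  obtain ⟨s', s, hs', hs, hss, rfl⟩ := hu
  obtain ⟨t', t, ht', ht, htt, rfl⟩ := hw
  obtain rfl : s' = 1 - s := by linarith
  obtain rfl : t' = 1 - t := by linarith
  rw [Set.not_disjoint_iff]
  rcases hs.eq_or_lt with rfl | hs0
  · exact ⟨x, right_mem_segment ℝ α x, by simpa using huβ⟩
  -- With u = (1 - s)x + sz and w = (1 - t)y + tz, solving for the common point of xw and yu gives
  -- weights s/D and t/D. The case s = 0 is set apart because D could vanish.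
  obtain ⟨D, hD⟩ : ∃ D, D = t + s - s * t := ⟨_, rfl⟩
  have hD0 : 0 < D := by nlinarith
  refine ⟨_, hxw ⟨1 - s / D, s / D, ?_, by positivity, by ring, rfl⟩,
    hyu ⟨1 - t / D, t / D, ?_, by positivity, by ring, ?_⟩⟩
  · rw [sub_nonneg, div_le_one hD0]; nlinarith
  · rw [sub_nonneg, div_le_one hD0]; nlinarith
  · match_scalars <;> field_simp <;> rw [hD] <;> ring

/-! ### Angular order around an extreme point. -/

section Angular

variable {p a b c : Plane}

/-- The point `q` is greater than `p` in the lexicographic order of the coordinates. -/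
def LexAbove (p q : Plane) : Prop := p 0 < q 0 ∨ p 0 = q 0 ∧ p 1 < q 1

/-- All directions from `p` lie in a half-open half-plane, so turning left cannot go full circle. -/
theorem orient_trans (ha : LexAbove p a) (hb : LexAbove p b) (hc : LexAbove p c)
    (hab : 0 < orient p a b) (hbc : 0 < orient p b c) : 0 < orient p a c := by
  have key : orient p a c * (b 0 - p 0) =
      orient p b c * (a 0 - p 0) + orient p a b * (c 0 - p 0) := by
    unfold orient; ring
  have ha0 : 0 ≤ a 0 - p 0 := by rcases ha with h | h <;> linarith [h]
  have hc0 : 0 ≤ c 0 - p 0 := by rcases hc with h | h <;> linarith [h]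
  rcases hb with hb | ⟨hb, hb'⟩
  · have hnn : 0 < orient p b c * (a 0 - p 0) + orient p a b * (c 0 - p 0) := by
      rcases ha with ha | ⟨ha, ha'⟩
      · nlinarith [mul_pos hbc (sub_pos.2 ha)]
      · unfold orient at hab
        rw [← ha] at hab
        nlinarith [mul_pos (sub_pos.2 ha') (sub_pos.2 hb)]
    rw [← key] at hnn
    exact pos_of_mul_pos_left hnn (sub_pos.2 hb).le
  · unfold orient at hbc
    rw [← hb] at hbc
    nlinarith

theorem exists_forall_lexAbove {T : Finset Plane} (hT : T.Nonempty) :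
    ∃ p ∈ T, ∀ q ∈ T, q ≠ p → LexAbove p q := by
  obtain ⟨p, hp, hmin⟩ := T.exists_min_image (fun q => toLex (q 0, q 1)) hT
  refine ⟨p, hp, fun q hq hqp => ?_⟩
  rcases Prod.Lex.toLex_le_toLex.1 (hmin q hq) with h | ⟨h, h'⟩
  · exact Or.inl h
  · refine Or.inr ⟨h, lt_of_le_of_ne h' fun h1 => hqp ?_⟩
    ext i
    fin_cases i
    · exact h.symm
    · exact h1.symm

end Angular

theorem Finset.exists_least_of_trans {α : Type*} [DecidableEq α] (r : α → α → Prop) {s : Finset α}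
    (hs : s.Nonempty) (htot : ∀ a ∈ s, ∀ b ∈ s, a ≠ b → r a b ∨ r b a)
    (htrans : ∀ a ∈ s, ∀ b ∈ s, ∀ c ∈ s, r a b → r b c → r a c) :
    ∃ m ∈ s, ∀ x ∈ s, x ≠ m → r m x := by
  induction hs using Finset.Nonempty.cons_induction with
  | singleton a => exact ⟨a, by simp, by simp⟩
  | cons a s ha hs ih =>
    obtain ⟨m, hm, hmin⟩ := ih
      (fun x hx y hy => htot x (by simp [hx]) y (by simp [hy]))
      (fun x hx y hy z hz => htrans x (by simp [hx]) y (by simp [hy]) z (by simp [hz]))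
    have hma : m ≠ a := by rintro rfl; exact ha hm
    rcases htot m (by simp [hm]) a (by simp) hma with h | h
    · refine ⟨m, by simp [hm], fun x hx hxm => ?_⟩
      rcases Finset.mem_cons.1 hx with rfl | hx
      · exact h
      · exact hmin x hx hxm
    · refine ⟨a, by simp, fun x hx hxa => ?_⟩
      have hx := (Finset.mem_cons.1 hx).resolve_left hxa
      by_cases hxm : x = m
      · exact hxm ▸ h
      · exact htrans a (by simp) m (by simp [hm]) x (by simp [hx]) h (hmin x hx hxm)

/-! ### Intersecting families, sides of a line, and the hull. -/

noncomputable section Cuts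

open scoped Classical

/-- The segment spanned by an unordered pair of points. -/
def seg : Sym2 Plane → Set Plane := Sym2.lift ⟨fun a b => segment ℝ a b, segment_symm ℝ⟩

@[simp] theorem seg_mk (a b : Plane) : seg s(a, b) = segment ℝ a b := rfl

/-- The unordered pairs of distinct points of `T`. -/
def pairs (T : Finset Plane) : Finset (Sym2 Plane) := T.offDiag.image Sym2.mk.uncurry

@[simp] theorem mk_mem_pairs {T : Finset Plane} {a b : Plane} :
    s(a, b) ∈ pairs T ↔ a ∈ T ∧ b ∈ T ∧ a ≠ b := by
  simp only [pairs, Finset.mem_image, Finset.mem_offDiag, Prod.exists, Function.uncurry_apply_pair,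
    Sym2.eq_iff]
  constructor
  · rintro ⟨x, y, ⟨hx, hy, hxy⟩, ⟨rfl, rfl⟩ | ⟨rfl, rfl⟩⟩
    · exact ⟨hx, hy, hxy⟩
    · exact ⟨hy, hx, hxy.symm⟩
  · exact fun h => ⟨a, b, h, Or.inl ⟨rfl, rfl⟩⟩

theorem card_pairs (T : Finset Plane) : (pairs T).card = T.card.choose 2 :=
  Sym2.card_image_offDiag T

theorem pairs_mono {T T' : Finset Plane} (h : T' ⊆ T) : pairs T' ⊆ pairs T :=
  Finset.image_subset_image (Finset.offDiag_mono h)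

/-- A family of pairwise intersecting segments between points in general position has at most as many
members as there are points. -/
theorem card_le_of_pairwise_intersecting {T : Finset Plane} (hT : InGeneralPosition T)
    {F : Finset (Sym2 Plane)} (hF : F ⊆ pairs T)
    (hint : ∀ e ∈ F, ∀ f ∈ F, ¬ Disjoint (seg e) (seg f)) : F.card ≤ T.card := by
  -- Each member has an end `u` at which no other member lies strictly to its right; otherwise
  -- members at its two ends, on opposite sides of it, would be disjoint. At a given `u` only one
  -- member is extreme in this way, so choosing `u` is injective.
  have key : ∀ e : Sym2 Plane, e ∈ F →
      ∃ u ∈ T, ∃ v, e = s(u, v) ∧ ∀ x, s(u, x) ∈ F → 0 ≤ orient u v x := by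
    intro e he
    induction e using Sym2.ind with
    | _ u v =>
      obtain ⟨hu, hv, -⟩ := mk_mem_pairs.1 (hF he)
      by_contra! hcon
      obtain ⟨x, hx, hux⟩ := hcon u hu v rfl
      obtain ⟨y, hy, hvy⟩ := hcon v hv u Sym2.eq_swap
      rw [orient_swap_left] at hvy
      exact hint _ hx _ hy (disjoint_segment_of_opposite hux (by linarith))
  choose! f hfT v hv hf using key
  refine Finset.card_le_card_of_injOn f hfT fun e he e' he' hee => ?_
  have he1 : e = s(f e, v e) := hv e he
  have he2 : e' = s(f e, v e') := by rw [hee]; exact hv e' he'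
  by_contra hne
  have hvv : v e ≠ v e' := fun h => hne (by rw [he1, he2, h])
  have h1 := hf e he (v e') (he2 ▸ he')
  have h2 := hf e' he' (v e) (by rw [← hee]; exact he1 ▸ he)
  rw [← hee, orient_swap_right] at h2
  have m1 := mk_mem_pairs.1 (he1 ▸ hF he)
  have m2 := mk_mem_pairs.1 (he2 ▸ hF he')
  exact hT.orient_ne_zero m1.1 m1.2.1 m2.2.1 m1.2.2 m2.2.2 hvv (by linarith)

/-- The points of `T` strictly to the left of the line from `p` to `v`. -/
def leftOf (T : Finset Plane) (p v : Plane) : Finset Plane := T.filter fun q => 0 < orient p v q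

theorem mem_leftOf {T : Finset Plane} {p v q : Plane} :
    q ∈ leftOf T p v ↔ q ∈ T ∧ 0 < orient p v q := Finset.mem_filter

theorem card_leftOf_add_card_leftOf {T : Finset Plane} (hT : InGeneralPosition T) {a b : Plane}
    (ha : a ∈ T) (hb : b ∈ T) (hab : a ≠ b) :
    (leftOf T a b).card + (leftOf T b a).card + 2 = T.card := by
  have hdisj : Disjoint (leftOf T a b) (leftOf T b a) := by
    rw [Finset.disjoint_left]
    intro q h1 h2
    have h3 := (mem_leftOf.1 h2).2
    rw [orient_swap_left] at h3
    linarith [(mem_leftOf.1 h1).2]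
  have hU : leftOf T a b ∪ leftOf T b a = (T.erase a).erase b := by
    ext q
    simp only [Finset.mem_union, mem_leftOf, Finset.mem_erase]
    constructor
    · rintro (⟨hq, h⟩ | ⟨hq, h⟩)
      · refine ⟨?_, ?_, hq⟩ <;> rintro rfl <;> simp at h
      · refine ⟨?_, ?_, hq⟩ <;> rintro rfl <;> simp at h
    · rintro ⟨hqb, hqa, hq⟩
      have := hT.orient_ne_zero ha hb hq hab hqa.symm hqb.symm
      rw [orient_swap_left a b]
      rcases this.lt_or_gt with h | h
      · exact Or.inr ⟨hq, by linarith⟩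
      · exact Or.inl ⟨hq, h⟩
  rw [← Finset.card_union_of_disjoint hdisj, hU,
    Finset.card_erase_of_mem (Finset.mem_erase.2 ⟨hab.symm, hb⟩), Finset.card_erase_of_mem ha]
  have : 1 < T.card := Finset.one_lt_card.2 ⟨a, ha, b, hb, hab⟩
  omega

theorem disjoint_seg_of_mem_leftOf {T : Finset Plane} {p v : Plane} {e : Sym2 Plane}
    (he : e ∈ pairs (leftOf T p v)) : Disjoint (segment ℝ p v) (seg e) := by
  induction e using Sym2.ind with
  | _ x y =>
    obtain ⟨hx, hy, -⟩ := mk_mem_pairs.1 he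
    exact disjoint_segment_of_orient (a := p) (b := v) (by simp) (by simp)
      (mem_leftOf.1 hx).2 (mem_leftOf.1 hy).2

/-- A lower bound for the size of the cuts of the disjointness graph of `n` points. -/
def cutBound (n : ℕ) : ℕ :=
  if n ≤ 4 then 0 else if n = 5 then 1 else if n = 6 then 2 else if n = 7 then 4
  else if n = 8 then 6 else n

/-- For 4 < n ≤ 9 the value `cutBound n` is the minimum of the right side over x + y = n - 2,
attained by the balanced split. Beyond 9 the value n suffices. -/
theorem cutBound_le_choose_add_choose (x y : ℕ) :
    cutBound (x + y + 2) ≤ x.choose 2 + y.choose 2 := by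
  have hx : x.choose 2 * 2 + x = x * x := by
    rw [Nat.choose_two_right, Nat.div_mul_cancel (Nat.even_mul_pred_self x).two_dvd]
    cases x <;> simp; ring
  have hy : y.choose 2 * 2 + y = y * y := by
    rw [Nat.choose_two_right, Nat.div_mul_cancel (Nat.even_mul_pred_self y).two_dvd]
    cases y <;> simp; ring
  rcases Nat.lt_or_ge (x + y) 8 with h | h
  · have h1 : x < 8 := by omega
    have h2 : y < 8 := by omega
    interval_cases x <;> interval_cases y <;> simp [cutBound] at * <;> omega
  · have : cutBound (x + y + 2) = x + y + 2 := by
      unfold cutBound; split_ifs <;> omega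
    rw [this]
    zify at *
    nlinarith [sq_nonneg ((x : ℤ) - y)]

/-- A segment is disjoint from every segment lying strictly on one side of its line. -/
theorem cutBound_le_card_disjoint {T : Finset Plane} (hT : InGeneralPosition T) {e : Sym2 Plane}
    (he : e ∈ pairs T) :
    cutBound T.card ≤ ((pairs T).filter fun f => Disjoint (seg e) (seg f)).card := by
  induction e using Sym2.ind with
  | _ a b =>
    obtain ⟨ha, hb, hab⟩ := mk_mem_pairs.1 he
    rw [← card_leftOf_add_card_leftOf hT ha hb hab]
    refine (cutBound_le_choose_add_choose _ _).trans ?_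
    rw [← card_pairs, ← card_pairs, ← Finset.card_union_of_disjoint]
    · refine Finset.card_le_card fun f hf => ?_
      rcases Finset.mem_union.1 hf with hf | hf
      · exact Finset.mem_filter.2 ⟨pairs_mono (Finset.filter_subset _ _) hf,
          disjoint_seg_of_mem_leftOf hf⟩
      · exact Finset.mem_filter.2 ⟨pairs_mono (Finset.filter_subset _ _) hf, by
          rw [seg_mk, segment_symm]; exact disjoint_seg_of_mem_leftOf hf⟩
    · rw [Finset.disjoint_left]
      intro f h1 h2
      induction f using Sym2.ind with
      | _ x y =>
        have h3 := (mem_leftOf.1 (mk_mem_pairs.1 h1).1).2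
        have h4 := (mem_leftOf.1 (mk_mem_pairs.1 h2).1).2
        rw [orient_swap_left] at h4
        linarith

/-- A boundary point `p` of the convex hull, with the first two and the last of the other points in
their order around `p`. -/
theorem exists_hull_order {T : Finset Plane} (hT : InGeneralPosition T) (hc : 4 ≤ T.card) :
    ∃ p ∈ T, ∃ v ∈ T, ∃ u ∈ T, ∃ w ∈ T, p ≠ v ∧ p ≠ u ∧ p ≠ w ∧ v ≠ u ∧ v ≠ w ∧ u ≠ w ∧
      leftOf T p v = (T.erase p).erase v ∧ leftOf T p u = ((T.erase p).erase v).erase u ∧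
      leftOf T w p = (T.erase p).erase w := by
  obtain ⟨p, hp, hlex⟩ := exists_forall_lexAbove (T := T) (Finset.card_pos.1 (by omega))
  set Q := T.erase p with hQdef
  have hQ : Q.card = T.card - 1 := Finset.card_erase_of_mem hp
  have hQm : ∀ q ∈ Q, q ∈ T ∧ p ≠ q ∧ LexAbove p q := fun q hq =>
    ⟨Finset.mem_of_mem_erase hq, (Finset.ne_of_mem_erase hq).symm,
      hlex q (Finset.mem_of_mem_erase hq) (Finset.ne_of_mem_erase hq)⟩
  have htot : ∀ a ∈ Q, ∀ b ∈ Q, a ≠ b → 0 < orient p a b ∨ 0 < orient p b a := by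
    intro a ha b hb hab
    rw [orient_swap_right p a b]
    rcases (hT.orient_ne_zero hp (hQm a ha).1 (hQm b hb).1 (hQm a ha).2.1 (hQm b hb).2.1
      hab).lt_or_gt with h | h
    · exact Or.inr (by linarith)
    · exact Or.inl h
  have htr : ∀ a ∈ Q, ∀ b ∈ Q, ∀ c ∈ Q, 0 < orient p a b → 0 < orient p b c → 0 < orient p a c :=
    fun a ha b hb c hc => orient_trans (hQm a ha).2.2 (hQm b hb).2.2 (hQm c hc).2.2
  obtain ⟨v, hv, hvmin⟩ := Finset.exists_least_of_trans (fun a b => 0 < orient p a b) (s := Q)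
    (Finset.card_pos.1 (by omega)) htot htr
  obtain ⟨w, hw, hwmax⟩ := Finset.exists_least_of_trans (fun a b => 0 < orient p b a) (s := Q)
    (Finset.card_pos.1 (by omega)) (fun a ha b hb h => (htot a ha b hb h).symm)
    (fun a ha b hb c hc h1 h2 => htr c hc b hb a ha h2 h1)
  have hQv : (Q.erase v).card = Q.card - 1 := Finset.card_erase_of_mem hv
  obtain ⟨u, hu, humin⟩ := Finset.exists_least_of_trans (fun a b => 0 < orient p a b)
    (s := Q.erase v) (Finset.card_pos.1 (by omega))
    (fun a ha b hb => htot a (Finset.mem_of_mem_erase ha) b (Finset.mem_of_mem_erase hb))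
    (fun a ha b hb c hc => htr a (Finset.mem_of_mem_erase ha) b (Finset.mem_of_mem_erase hb) c
      (Finset.mem_of_mem_erase hc))
  have huv : u ≠ v := Finset.ne_of_mem_erase hu
  have huQ : u ∈ Q := Finset.mem_of_mem_erase hu
  have hvu : 0 < orient p v u := hvmin u huQ huv
  have hvw : v ≠ w := by
    rintro rfl
    have := hwmax u huQ huv
    rw [orient_swap_right] at this
    linarith
  have huw : u ≠ w := by
    rintro rfl
    -- With four points there is one besides `p`, `v`, `u`; it comes after `u`, so `u` is not last.
    obtain ⟨q, hq⟩ : ((Q.erase v).erase u).Nonempty := by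
      rw [← Finset.card_pos, Finset.card_erase_of_mem hu]; omega
    have h1 := humin q (Finset.mem_of_mem_erase hq) (Finset.ne_of_mem_erase hq)
    have h2 := hwmax q (Finset.mem_of_mem_erase (Finset.mem_of_mem_erase hq))
      (Finset.ne_of_mem_erase hq)
    rw [orient_swap_right] at h2
    linarith
  refine ⟨p, hp, v, (hQm v hv).1, u, (hQm u huQ).1, w, (hQm w hw).1, (hQm v hv).2.1,
    (hQm u huQ).2.1, (hQm w hw).2.1, huv.symm, hvw, huw, ?_, ?_, ?_⟩
  · ext q
    rw [mem_leftOf, Finset.mem_erase]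
    constructor
    · rintro ⟨hq, h⟩
      refine ⟨?_, Finset.mem_erase.2 ⟨?_, hq⟩⟩ <;> rintro rfl <;> simp at h
    · exact fun ⟨h, hq⟩ => ⟨(hQm q hq).1, hvmin q hq h⟩
  · ext q
    rw [mem_leftOf, Finset.mem_erase]
    constructor
    · rintro ⟨hq, h⟩
      refine ⟨?_, Finset.mem_erase.2 ⟨?_, Finset.mem_erase.2 ⟨?_, hq⟩⟩⟩
      · rintro rfl; simp at h
      · rintro rfl
        rw [orient_swap_right] at h
        linarith
      · rintro rfl; simp at h
    · exact fun ⟨h, hq⟩ => ⟨(hQm q (Finset.mem_of_mem_erase hq)).1, humin q hq h⟩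
  · ext q
    rw [mem_leftOf, Finset.mem_erase]
    constructor
    · rintro ⟨hq, h⟩
      refine ⟨?_, Finset.mem_erase.2 ⟨?_, hq⟩⟩ <;> rintro rfl <;> simp at h
    · rintro ⟨h, hq⟩
      have h1 := hwmax q hq h
      rw [orient_swap_right] at h1
      rw [orient_swap_left]
      exact ⟨(hQm q hq).1, h1⟩

/-! ### Colourings with few uncoloured pairs at each point. -/

/-- The pairs of points of `T` which are not in `D`. -/
def uncolored (D : Set (Sym2 Plane)) (T : Finset Plane) : Finset (Sym2 Plane) :=
  (pairs T).filter fun e => e ∉ D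

theorem mem_uncolored {D : Set (Sym2 Plane)} {T : Finset Plane} {e : Sym2 Plane} :
    e ∈ uncolored D T ↔ e ∈ pairs T ∧ e ∉ D := Finset.mem_filter

/-- The points of `T` whose pair with `p` is not in `D`. -/
def missing (D : Set (Sym2 Plane)) (T : Finset Plane) (p : Plane) : Finset Plane :=
  (T.erase p).filter fun q => s(p, q) ∉ D

theorem mem_missing {D : Set (Sym2 Plane)} {T : Finset Plane} {p q : Plane} :
    q ∈ missing D T p ↔ q ≠ p ∧ q ∈ T ∧ s(p, q) ∉ D := by
  simp [missing, and_assoc]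

theorem card_uncolored_erase_add_card_missing_le (D : Set (Sym2 Plane)) {T : Finset Plane}
    {p : Plane} (hp : p ∈ T) :
    (uncolored D (T.erase p)).card + (missing D T p).card ≤ (uncolored D T).card := by
  have hinj : Set.InjOn (fun q => s(p, q)) (missing D T p : Set Plane) := fun x _ y _ h =>
    Sym2.congr_right.1 h
  rw [← Finset.card_image_of_injOn hinj, ← Finset.card_union_of_disjoint]
  · refine Finset.card_le_card (Finset.union_subset ?_ ?_)
    · exact Finset.filter_subset_filter _ (pairs_mono (Finset.erase_subset _ _))
    · intro e he
      obtain ⟨q, hq, rfl⟩ := Finset.mem_image.1 he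
      obtain ⟨h1, h2, h3⟩ := mem_missing.1 hq
      exact Finset.mem_filter.2 ⟨mk_mem_pairs.2 ⟨hp, h2, h1.symm⟩, h3⟩
  · rw [Finset.disjoint_left]
    intro e he he'
    obtain ⟨q, hq, rfl⟩ := Finset.mem_image.1 he'
    have := (mk_mem_pairs.1 (Finset.mem_filter.1 he).1).1
    simp at this

/-- Two families `B` and `R` of pairs such that the segments of `B` meet those of `R`, that no pair in
one of them meets all others in it, and that few pairs of points of `T` belong to neither. -/
structure IsTightCut (T : Finset Plane) (B R : Set (Sym2 Plane)) (d : ℕ) : Prop where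
  gp : InGeneralPosition T
  meet : ∀ b ∈ B, ∀ r ∈ R, ¬ Disjoint (seg b) (seg r)
  exists_left : ∃ e ∈ pairs T, e ∈ B
  disjoint_left : ∀ e ∈ pairs T, e ∈ B → ∃ f ∈ pairs T, f ∈ B ∧ Disjoint (seg e) (seg f)
  exists_right : ∃ e ∈ pairs T, e ∈ R
  disjoint_right : ∀ e ∈ pairs T, e ∈ R → ∃ f ∈ pairs T, f ∈ R ∧ Disjoint (seg e) (seg f)
  card_missing_le : ∀ p ∈ T, (missing (B ∪ R) T p).card ≤ d

namespace IsTightCut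

variable {T : Finset Plane} {B R : Set (Sym2 Plane)} {d : ℕ}

theorem symm (h : IsTightCut T B R d) : IsTightCut T R B d where
  gp := h.gp
  meet r hr b hb hrb := h.meet b hb r hr hrb.symm
  exists_left := h.exists_right
  disjoint_left := h.disjoint_right
  exists_right := h.exists_left
  disjoint_right := h.disjoint_left
  card_missing_le := by rw [Set.union_comm]; exact h.card_missing_le

theorem notMem_left (h : IsTightCut T B R d) {p v x y : Plane} (hpv : s(p, v) ∈ R)
    (hx : x ∈ leftOf T p v) (hy : y ∈ leftOf T p v) : s(x, y) ∉ B := fun hB =>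
  h.meet _ hB _ hpv (disjoint_segment_of_orient (a := p) (b := v) (by simp) (by simp)
    (mem_leftOf.1 hx).2 (mem_leftOf.1 hy).2).symm

theorem mem_missing_or_mem_right (h : IsTightCut T B R d) {p v x y : Plane} (hpv : s(p, v) ∈ R)
    (hx : x ∈ leftOf T p v) (hy : y ∈ leftOf T p v) (hxy : x ≠ y) :
    y ∈ missing (B ∪ R) T x ∨ s(x, y) ∈ R := by
  by_cases hR : s(x, y) ∈ R
  · exact Or.inr hR
  · refine Or.inl (mem_missing.2 ⟨hxy.symm, (mem_leftOf.1 hy).1, ?_⟩)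
    rintro (hB | hR')
    · exact h.notMem_left hpv hx hy hB
    · exact hR hR'

/-- Every B-pair has exactly one end to the left of the R-pair `p v`; apply this to two disjoint
B-pairs. -/
theorem exists_crossing_pair (h : IsTightCut T B R d) {p v : Plane} (hpv : s(p, v) ∈ R)
    (hcard : d + 2 ≤ (leftOf T p v).card) :
    ∃ α β x y, α ∉ leftOf T p v ∧ β ∉ leftOf T p v ∧ α ∈ T ∧ β ∈ T ∧
      x ∈ leftOf T p v ∧ y ∈ leftOf T p v ∧ x ≠ y ∧ s(α, x) ∈ B ∧ s(β, y) ∈ B ∧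
      Disjoint (segment ℝ α x) (segment ℝ β y) := by
  have hin : ∀ a ∈ T, ∀ b ∈ T, s(a, b) ∈ B → a ∈ leftOf T p v ∨ b ∈ leftOf T p v := by
    intro a ha b hb hab
    by_contra! hcon
    have hle : ∀ c ∈ T, c ∉ leftOf T p v → orient p v c ≤ 0 := fun c hc hc' =>
      not_lt.1 fun hlt => hc' (mem_leftOf.2 ⟨hc, hlt⟩)
    -- With d + 2 points on the left, some `z` there differs from `x` and is not missing at `x`, so
    -- `x z` is in R. The line `p v` separates it from any pair with no end on the left.
    obtain ⟨x, hx⟩ := Finset.card_pos.1 (by omega : 0 < (leftOf T p v).card)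
    obtain ⟨z, hz, hzx⟩ := Finset.exists_mem_notMem_of_card_lt_card
      (s := insert x (missing (B ∪ R) T x)) (t := leftOf T p v) (by
        have := h.card_missing_le x (mem_leftOf.1 hx).1
        have := Finset.card_insert_le x (missing (B ∪ R) T x)
        omega)
    rw [Finset.mem_insert, not_or] at hzx
    have hR := (h.mem_missing_or_mem_right hpv hx hz (Ne.symm hzx.1)).resolve_left hzx.2
    exact h.meet _ hab _ hR (disjoint_segment_of_orient (hle a ha hcon.1) (hle b hb hcon.2)
      (mem_leftOf.1 hx).2 (mem_leftOf.1 hz).2)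
  have horder : ∀ e ∈ pairs T, e ∈ B → ∃ α x, e = s(α, x) ∧ α ∈ T ∧ α ∉ leftOf T p v ∧
      x ∈ leftOf T p v := by
    intro e he heB
    induction e using Sym2.ind with
    | _ a b =>
      obtain ⟨ha, hb, -⟩ := mk_mem_pairs.1 he
      by_cases hal : a ∈ leftOf T p v
      · by_cases hbl : b ∈ leftOf T p v
        · exact absurd heB (h.notMem_left hpv hal hbl)
        · exact ⟨b, a, Sym2.eq_swap, hb, hbl, hal⟩
      · exact ⟨a, b, rfl, ha, hal, (hin a ha b hb heB).resolve_left hal⟩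
  obtain ⟨e, he, heB⟩ := h.exists_left
  obtain ⟨f, hf, hfB, hdis⟩ := h.disjoint_left e he heB
  obtain ⟨α, x, rfl, hα, hαl, hx⟩ := horder e he heB
  obtain ⟨β, y, rfl, hβ, hβl, hy⟩ := horder f hf hfB
  refine ⟨α, β, x, y, hαl, hβl, hα, hβ, hx, hy, ?_, heB, hfB, hdis⟩
  rintro rfl
  exact Set.disjoint_left.1 hdis (right_mem_segment ℝ α x) (right_mem_segment ℝ β x)

/-- If `x z` and `y z` were both in R, then `β y` would meet the side `x z` and `α x` the side `y z`
of the triangle `x y z`, so these disjoint B-segments would meet as cevians. -/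
theorem mem_missing_of_crossing_pair (h : IsTightCut T B R d) {p v α β x y z : Plane}
    (hpv : s(p, v) ∈ R) (hx : x ∈ leftOf T p v) (hy : y ∈ leftOf T p v) (hz : z ∈ leftOf T p v)
    (hzx : z ≠ x) (hzy : z ≠ y) (hαx : s(α, x) ∈ B) (hβy : s(β, y) ∈ B)
    (hdis : Disjoint (segment ℝ α x) (segment ℝ β y)) :
    z ∈ missing (B ∪ R) T x ∨ z ∈ missing (B ∪ R) T y := by
  rcases h.mem_missing_or_mem_right hpv hx hz hzx.symm with h1 | h1
  · exact Or.inl h1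
  rcases h.mem_missing_or_mem_right hpv hy hz hzy.symm with h2 | h2
  · exact Or.inr h2
  exact absurd hdis (segment_inter_nonempty_of_cevians
    (fun hd => h.meet _ hβy _ h1 hd.symm) (fun hd => h.meet _ hαx _ h2 hd.symm))

theorem sdiff_subset_missing_union (h : IsTightCut T B R d) {p v α β x y : Plane}
    (hpv : s(p, v) ∈ R) (hx : x ∈ leftOf T p v) (hy : y ∈ leftOf T p v)
    (hαx : s(α, x) ∈ B) (hβy : s(β, y) ∈ B)
    (hdis : Disjoint (segment ℝ α x) (segment ℝ β y)) :
    ((leftOf T p v).erase x).erase y ⊆ missing (B ∪ R) T x ∪ missing (B ∪ R) T y := by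
  intro z hz
  simp only [Finset.mem_erase] at hz
  exact Finset.mem_union.2 (h.mem_missing_of_crossing_pair hpv hx hy hz.2.2 hz.2.1 hz.1 hαx hβy hdis)

theorem card_leftOf_le (h : IsTightCut T B R d) {p v : Plane} (hpv : s(p, v) ∈ R) :
    (leftOf T p v).card ≤ 2 * d + 2 := by
  by_contra! hcard
  obtain ⟨α, β, x, y, -, -, -, -, hx, hy, hxy, hαx, hβy, hdis⟩ :=
    h.exists_crossing_pair hpv (by omega)
  have h1 := (Finset.card_le_card
    (h.sdiff_subset_missing_union hpv hx hy hαx hβy hdis)).trans (Finset.card_union_le _ _)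
  rw [Finset.card_erase_of_mem (Finset.mem_erase.2 ⟨hxy.symm, hy⟩),
    Finset.card_erase_of_mem hx] at h1
  have h2 := h.card_missing_le x (mem_leftOf.1 hx).1
  have h3 := h.card_missing_le y (mem_leftOf.1 hy).1
  omega

theorem mul_orient_neg_of_mem (h : IsTightCut T B R d) {β y c e : Plane} (hβy : s(β, y) ∈ B)
    (hce : s(c, e) ∈ R) (hβ : β ∈ T) (hy : y ∈ T) (hc : c ∈ T) (he : e ∈ T) (hβy' : β ≠ y)
    (hβc : β ≠ c) (hβe : β ≠ e) (hyc : y ≠ c) (hye : y ≠ e) :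
    orient β y c * orient β y e < 0 := by
  refine lt_of_le_of_ne (not_lt.1 fun hpos => h.meet _ hβy _ hce
    (disjoint_segment_of_mul_orient_pos hpos)) (mul_ne_zero ?_ ?_)
  · exact h.gp.orient_ne_zero hβ hy hc hβy' hβc hyc
  · exact h.gp.orient_ne_zero hβ hy he hβy' hβe hye

theorem missing_comm {D : Set (Sym2 Plane)} {a b : Plane} (ha : a ∈ T)
    (hb : b ∈ missing D T a) : a ∈ missing D T b := by
  obtain ⟨h1, -, h3⟩ := mem_missing.1 hb
  exact mem_missing.2 ⟨h1.symm, ha, by rwa [Sym2.eq_swap]⟩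

/-- With six points on the left the count behind `card_leftOf_le` is tight. The missing pair from
`w` to the outside then forces an R-triangle whose three sides are all met by one B-segment, though
a line avoiding the vertices cannot separate all three pairs of them. -/
theorem card_leftOf_lt_of_mem_missing (h : IsTightCut T B R 2) {p v q w : Plane}
    (hpv : s(p, v) ∈ R) (hw : w ∈ leftOf T p v) (hqw : q ∈ missing (B ∪ R) T w)
    (hq : q ∉ leftOf T p v) : (leftOf T p v).card < 6 := by
  by_contra! hcard
  obtain ⟨α, β, x, y, hαl, hβl, hα, hβ, hx, hy, hxy, hαx, hβy, hdis⟩ :=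
    h.exists_crossing_pair hpv (by omega)
  have hL : ∀ {c}, c ∈ leftOf T p v → c ∈ T := fun hc => (mem_leftOf.1 hc).1
  -- By symmetry `w` may be assumed to be joined to `y` by an uncolored pair.
  have main : ∀ {α β x y : Plane}, β ∉ leftOf T p v → β ∈ T →
      x ∈ leftOf T p v → y ∈ leftOf T p v → x ≠ y → s(α, x) ∈ B → s(β, y) ∈ B →
      Disjoint (segment ℝ α x) (segment ℝ β y) → w ≠ x → w ≠ y →
      w ∈ missing (B ∪ R) T y → False := by
    intro α β x y hβl hβ hx hy hxy hαx hβy hdis hwx hwy hwm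
    have hsub := h.sdiff_subset_missing_union hpv hx hy hαx hβy hdis
    have hZ : (((leftOf T p v).erase x).erase y).card = (leftOf T p v).card - 1 - 1 := by
      rw [Finset.card_erase_of_mem (Finset.mem_erase.2 ⟨hxy.symm, hy⟩),
        Finset.card_erase_of_mem hx]
    have hcx := h.card_missing_le x (hL hx)
    have hcy := h.card_missing_le y (hL hy)
    have hcw := h.card_missing_le w (hL hw)
    have hun := Finset.card_union_add_card_inter (missing (B ∪ R) T x) (missing (B ∪ R) T y)
    have hle := Finset.card_le_card hsub
    -- At least four points are covered by two sets of size at most two, so the sets are disjoint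
    -- and cover exactly these points.
    have hinter : Disjoint (missing (B ∪ R) T x) (missing (B ∪ R) T y) := by
      rw [Finset.disjoint_iff_inter_eq_empty, ← Finset.card_eq_zero]; omega
    have heq := Finset.eq_of_subset_of_card_le hsub (by omega)
    obtain ⟨z, hz, hzw⟩ := Finset.exists_mem_ne
      (by omega : 1 < (missing (B ∪ R) T y).card) w
    have hzl : z ∈ ((leftOf T p v).erase x).erase y := heq ▸ Finset.mem_union_right _ hz
    simp only [Finset.mem_erase] at hzl
    obtain ⟨hzy, hzx, hzl⟩ := hzl
    have hxw : s(x, w) ∈ R := (h.mem_missing_or_mem_right hpv hx hw hwx.symm).resolve_left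
      fun hm => Finset.disjoint_left.1 hinter hm hwm
    have hxz : s(x, z) ∈ R := (h.mem_missing_or_mem_right hpv hx hzl hzx.symm).resolve_left
      fun hm => Finset.disjoint_left.1 hinter hm hz
    -- `w` already misses `q` and `y`, which exhausts its two uncoloured pairs.
    have hwz : s(w, z) ∈ R := by
      refine (h.mem_missing_or_mem_right hpv hw hzl hzw.symm).resolve_left fun hm => ?_
      have hyw : y ∈ missing (B ∪ R) T w := missing_comm (hL hy) hwm
      have hqy : q ≠ y := by rintro rfl; exact hq hy
      have hqz : q ≠ z := by rintro rfl; exact hq hzl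
      have : 2 < (missing (B ∪ R) T w).card :=
        Finset.two_lt_card.2 ⟨q, hqw, y, hyw, z, hm, hqy, hqz, hzy.symm⟩
      omega
    have hne : ∀ {c}, c ∈ leftOf T p v → β ≠ c := by rintro c hc rfl; exact hβl hc
    have n1 := h.mul_orient_neg_of_mem hβy hxw hβ (hL hy) (hL hx) (hL hw) (hne hy) (hne hx)
      (hne hw) hxy.symm hwy.symm
    have n2 := h.mul_orient_neg_of_mem hβy hxz hβ (hL hy) (hL hx) (hL hzl) (hne hy) (hne hx)
      (hne hzl) hxy.symm hzy.symm
    have n3 := h.mul_orient_neg_of_mem hβy hwz hβ (hL hy) (hL hw) (hL hzl) (hne hy) (hne hw)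
      (hne hzl) hwy.symm hzy.symm
    -- The product of the three negative quantities would be a square.
    nlinarith [mul_pos_of_neg_of_neg n1 n2, sq_nonneg (orient β y x)]
  have hsub := h.sdiff_subset_missing_union hpv hx hy hαx hβy hdis
  have hZ : (((leftOf T p v).erase x).erase y).card = (leftOf T p v).card - 1 - 1 := by
    rw [Finset.card_erase_of_mem (Finset.mem_erase.2 ⟨hxy.symm, hy⟩),
      Finset.card_erase_of_mem hx]
  have hcx := h.card_missing_le x (hL hx)
  have hcy := h.card_missing_le y (hL hy)
  have hle := (Finset.card_le_card hsub).trans (Finset.card_union_le _ _)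
  have heq := Finset.eq_of_subset_of_card_le hsub
    ((Finset.card_union_le _ _).trans (by omega))
  have hqn : q ∉ missing (B ∪ R) T x ∪ missing (B ∪ R) T y := by
    rw [← heq]
    simp [hq]
  rw [Finset.mem_union, not_or] at hqn
  have hwx : w ≠ x := by rintro rfl; exact hqn.1 hqw
  have hwy : w ≠ y := by rintro rfl; exact hqn.2 hqw
  rcases h.mem_missing_of_crossing_pair hpv hx hy hw hwx hwy hαx hβy hdis with hm | hm
  · exact main hαl hα hy hx hxy.symm hβy hαx hdis.symm hwy hwx hm
  · exact main hβl hβ hx hy hxy hαx hβy hdis hwx hwy hm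

end IsTightCut

/-! ### The induction for the cut bound. -/

/-- More pairs are disjoint from `e` than are uncoloured, so one of them is coloured; it cannot be
in R. -/
theorem exists_disjoint_of_uncolored_lt {T : Finset Plane} (hT : InGeneralPosition T)
    {B R : Set (Sym2 Plane)} (hmeet : ∀ b ∈ B, ∀ r ∈ R, ¬ Disjoint (seg b) (seg r))
    (hlt : (uncolored (B ∪ R) T).card < cutBound T.card) {e : Sym2 Plane} (he : e ∈ pairs T)
    (heB : e ∈ B) : ∃ f ∈ pairs T, f ∈ B ∧ Disjoint (seg e) (seg f) := by
  obtain ⟨f, hf, hf'⟩ := Finset.exists_mem_notMem_of_card_lt_card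
    (hlt.trans_le (cutBound_le_card_disjoint hT he))
  obtain ⟨hfT, hdis⟩ := Finset.mem_filter.1 hf
  refine ⟨f, hfT, by_contra fun hfB => hf' (mem_uncolored.2 ⟨hfT, ?_⟩), hdis⟩
  rintro (h | h)
  · exact hfB h
  · exact hmeet e heB f h hdis

/-- If a pair of the colour contains `p`, a pair of that colour disjoint from it avoids `p`. -/
theorem exists_mem_pairs_erase {T : Finset Plane} {B : Set (Sym2 Plane)}
    (hex : ∃ e ∈ pairs T, e ∈ B)
    (hdis : ∀ e ∈ pairs T, e ∈ B → ∃ f ∈ pairs T, f ∈ B ∧ Disjoint (seg e) (seg f)) (p : Plane) :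
    ∃ e ∈ pairs (T.erase p), e ∈ B := by
  have herase : ∀ f ∈ pairs T, p ∉ f → f ∈ pairs (T.erase p) := by
    intro f hf hpf
    induction f using Sym2.ind with
    | _ a b =>
      obtain ⟨ha, hb, hab⟩ := mk_mem_pairs.1 hf
      simp only [Sym2.mem_iff, not_or] at hpf
      simp [ha, hb, hab, Ne.symm hpf.1, Ne.symm hpf.2]
  have hseg : ∀ f : Sym2 Plane, p ∈ f → p ∈ seg f := by
    intro f hf
    induction f using Sym2.ind with
    | _ a b =>
      rcases Sym2.mem_iff.1 hf with rfl | rfl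
      · exact left_mem_segment ℝ p b
      · exact right_mem_segment ℝ a p
  obtain ⟨e, he, heB⟩ := hex
  by_cases hpe : p ∈ e
  · obtain ⟨f, hf, hfB, hd⟩ := hdis e he heB
    exact ⟨f, herase f hf fun hpf => Set.disjoint_left.1 hd (hseg e hpe) (hseg f hpf), hfB⟩
  · exact ⟨e, herase e he hpe, heB⟩

/-- A lower bound for the cuts of the disjointness graph. -/
theorem cutBound_le_card_uncolored {B R : Set (Sym2 Plane)}
    (hmeet : ∀ b ∈ B, ∀ r ∈ R, ¬ Disjoint (seg b) (seg r)) (n : ℕ) :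
    ∀ T : Finset Plane, T.card = n → InGeneralPosition T → (∃ e ∈ pairs T, e ∈ B) →
      (∃ e ∈ pairs T, e ∈ R) → cutBound T.card ≤ (uncolored (B ∪ R) T).card := by
  induction n with
  | zero => intro T hT _ _ _; simp [hT, cutBound]
  | succ n ih =>
    intro T hTn hT hB hR
    rcases Nat.lt_or_ge n 4 with hn | hn
    · have : cutBound T.card = 0 := by unfold cutBound; split_ifs <;> omega
      omega
    by_contra! hlt
    have hB' := fun e (he : e ∈ pairs T) => exists_disjoint_of_uncolored_lt hT hmeet hlt he
    have hR' := fun e (he : e ∈ pairs T) => exists_disjoint_of_uncolored_lt hT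
      (fun r hr b hb hrb => hmeet b hb r hr hrb.symm) (Set.union_comm B R ▸ hlt) he
    rw [hTn] at hlt
    -- For n + 1 = 5, 6, 7, 8, 9 this is 0, 0, 1, 1, 2, and from 10 on it is 0.
    obtain ⟨d, hd⟩ : ∃ d, d = cutBound (n + 1) - cutBound n - 1 := ⟨_, rfl⟩
    have h : IsTightCut T B R d := by
      refine ⟨hT, hmeet, hB, hB', hR, hR', fun p hp => ?_⟩
      have hc : (T.erase p).card = n := by rw [Finset.card_erase_of_mem hp]; omega
      have h1 := ih (T.erase p) hc (hT.mono (Finset.erase_subset _ _))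
        (exists_mem_pairs_erase hB hB' p) (exists_mem_pairs_erase hR hR' p)
      have h2 := card_uncolored_erase_add_card_missing_le (B ∪ R) hp
      rw [hc] at h1
      omega
    have hd1 : 2 * d + 2 < n - 1 := by
      rw [hd]; unfold cutBound; split_ifs <;> omega
    have hd2 : d = 2 → n = 8 := by
      intro h2
      rw [hd] at h2
      unfold cutBound at h2
      split_ifs at h2 <;> omega
    have hd3 : d ≤ 2 := by
      rw [hd]; unfold cutBound; split_ifs <;> omega
    obtain ⟨p, hp, v, hv, u, hu, w, hw, hpv, hpu, hpw, hvu, hvw, huw, hLv, hLu, hLw⟩ :=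
      exists_hull_order hT (by omega)
    have hmiss : ∀ a ∈ T, ∀ b ∈ T, a ≠ b → 2 * d + 2 < (leftOf T a b).card →
        b ∈ missing (B ∪ R) T a := by
      intro a ha b hb hab hcard
      refine mem_missing.2 ⟨hab.symm, hb, ?_⟩
      rintro (hab' | hab')
      · exact absurd (h.symm.card_leftOf_le hab') (by omega)
      · exact absurd (h.card_leftOf_le hab') (by omega)
    have hcp : (T.erase p).card = n := by rw [Finset.card_erase_of_mem hp]; omega
    have hcv : ((T.erase p).erase v).card = n - 1 := by
      rw [Finset.card_erase_of_mem (by simp [hpv.symm, hv]), hcp]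
    have hcw : ((T.erase p).erase w).card = n - 1 := by
      rw [Finset.card_erase_of_mem (by simp [hpw.symm, hw]), hcp]
    -- The hull edges `p v` and `w p` have n - 1 > 2d + 2 points on one side, so neither is
    -- coloured.
    have hmv : v ∈ missing (B ∪ R) T p := hmiss p hp v hv hpv (by rw [hLv]; omega)
    have hmp : p ∈ missing (B ∪ R) T w := hmiss w hw p hp hpw.symm (by rw [hLw]; omega)
    have hmw : w ∈ missing (B ∪ R) T p := IsTightCut.missing_comm hw hmp
    have hdp := h.card_missing_le p hp
    have h2 : 1 < (missing (B ∪ R) T p).card := Finset.one_lt_card.2 ⟨v, hmv, w, hmw, hvw⟩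
    obtain rfl : d = 2 := by omega
    have hn8 := hd2 rfl
    have hcu : (leftOf T p u).card = 6 := by
      rw [hLu, Finset.card_erase_of_mem (by simp [hpu.symm, hvu.symm, hu]), hcv]
      omega
    have hwl : w ∈ leftOf T p u := by rw [hLu]; simp [huw.symm, hvw.symm, hpw.symm, hw]
    have hpl : p ∉ leftOf T p u := by rw [hLu]; simp
    -- The two hull edges use up the d = 2 missing pairs at `p`, so `p u`, with six points on its
    -- left, is coloured.
    have hmu : u ∉ missing (B ∪ R) T p := fun hm => by
      have := Finset.two_lt_card.2 ⟨v, hmv, w, hmw, u, hm, hvw, hvu, huw.symm⟩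
      omega
    have hcol : s(p, u) ∈ B ∪ R := by
      by_contra hcon
      exact hmu (mem_missing.2 ⟨hpu.symm, hu, hcon⟩)
    rcases hcol with hcol | hcol
    · have := h.symm.card_leftOf_lt_of_mem_missing hcol hwl (Set.union_comm B R ▸ hmp) hpl
      omega
    · have := h.card_leftOf_lt_of_mem_missing hcol hwl hmp hpl
      omega

/-! ### From pairs of points to vertices of the graph. -/

theorem seg_injOn {T : Finset Plane} (hT : InGeneralPosition T) :
    Set.InjOn seg (pairs T : Set (Sym2 Plane)) := by
  have key : ∀ a ∈ T, ∀ b ∈ T, a ≠ b → ∀ c ∈ T, c ∈ segment ℝ a b → c = a ∨ c = b := by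
    intro a ha b hb hab c hc hmem
    by_contra! hcon
    refine hT a ha b hb c hc hab hcon.1.symm hcon.2.symm ?_
    have hset : ({a, b, c} : Set Plane) = {a, c, b} := by rw [Set.pair_comm]
    exact hset ▸ (mem_segment_iff_wbtw.1 hmem).collinear
  intro e he f hf hef
  rw [Finset.mem_coe] at he hf
  induction e using Sym2.ind with
  | _ a b =>
    induction f using Sym2.ind with
    | _ c d =>
      obtain ⟨ha, hb, hab⟩ := mk_mem_pairs.1 he
      obtain ⟨hc, hd, hcd⟩ := mk_mem_pairs.1 hf
      rw [seg_mk, seg_mk] at hef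
      have h1 := key a ha b hb hab c hc (hef ▸ left_mem_segment ℝ c d)
      have h2 := key a ha b hb hab d hd (hef ▸ right_mem_segment ℝ c d)
      rw [Sym2.eq_iff]
      rcases h1 with rfl | rfl <;> rcases h2 with rfl | rfl <;> simp_all

theorem seg_mem_segmentsOf {T : Finset Plane} {e : Sym2 Plane} (he : e ∈ pairs T) :
    seg e ∈ segmentsOf T := by
  induction e using Sym2.ind with
  | _ a b =>
    obtain ⟨ha, hb, hab⟩ := mk_mem_pairs.1 he
    exact ⟨a, ha, b, hb, hab, rfl⟩

theorem exists_seg_eq {T : Finset Plane} (s : segmentsOf T) : ∃ e ∈ pairs T, seg e = s := by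
  obtain ⟨_, a, ha, b, hb, hab, rfl⟩ := s
  exact ⟨s(a, b), mk_mem_pairs.2 ⟨ha, hb, hab⟩, rfl⟩

theorem finite_segmentsOf (T : Finset Plane) : Finite (segmentsOf T) :=
  ((pairs T).finite_toSet.image seg).subset fun s hs => exists_seg_eq ⟨s, hs⟩

/-- A hull edge is disjoint from all segments between the other m ≥ 4 points. Since m(m - 1)/2 > m,
these do not all intersect pairwise, which yields a triangle in the graph. -/
theorem exists_isCycleList {T : Finset Plane} (hT : InGeneralPosition T) (hn : 6 ≤ T.card) :
    ∃ l, (disjointnessGraph T).IsCycleList l := by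
  obtain ⟨p, hp, v, hv, u, hu, w, hw, hpv, -, -, -, -, -, hL, -⟩ :=
    exists_hull_order hT (by omega)
  have hc : (leftOf T p v).card = T.card - 1 - 1 := by
    rw [hL, Finset.card_erase_of_mem (by simp [hpv.symm, hv]), Finset.card_erase_of_mem hp]
  have hsub : leftOf T p v ⊆ T := Finset.filter_subset _ _
  obtain ⟨e, he, f, hf, hef⟩ : ∃ e ∈ pairs (leftOf T p v), ∃ f ∈ pairs (leftOf T p v),
      Disjoint (seg e) (seg f) := by
    by_contra! hcon
    have h1 := card_le_of_pairwise_intersecting (hT.mono hsub) subset_rfl hcon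
    rw [card_pairs, Nat.choose_two_right] at h1
    obtain ⟨m, hm⟩ : ∃ m, (leftOf T p v).card = m + 4 := ⟨(leftOf T p v).card - 4, by omega⟩
    rw [hm, Nat.div_le_iff_le_mul_add_pred two_pos, show m + 4 - 1 = m + 3 by omega] at h1
    have h2 : 2 * (m + 4) + (2 - 1) < (m + 4) * (m + 3) := by norm_num; nlinarith
    omega
  have h0 : ∀ g, g ∈ pairs (leftOf T p v) → Disjoint (segment ℝ p v) (seg g) :=
    fun g hg => disjoint_seg_of_mem_leftOf hg
  have h1 : (disjointnessGraph T).Adj ⟨segment ℝ p v, p, hp, v, hv, hpv, rfl⟩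
    ⟨seg e, seg_mem_segmentsOf (pairs_mono hsub he)⟩ := h0 e he
  have h2 : (disjointnessGraph T).Adj ⟨seg e, seg_mem_segmentsOf (pairs_mono hsub he)⟩
    ⟨seg f, seg_mem_segmentsOf (pairs_mono hsub hf)⟩ := hef
  have h3 : (disjointnessGraph T).Adj ⟨seg f, seg_mem_segmentsOf (pairs_mono hsub hf)⟩
    ⟨segment ℝ p v, p, hp, v, hv, hpv, rfl⟩ := (h0 f hf).symm
  refine ⟨_, SimpleGraph.isCycleList_triple h1 h2 h3⟩

end Cuts

theorem lemma2 (P : Finset Plane) (hP : InGeneralPosition P) (hn : 9 ≤ P.card) :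
    ∃ (s : segmentsOf P) (C : (disjointnessGraph P).Walk s s), C.IsHamiltonianCycle := by
  classical
  have := finite_segmentsOf P
  have := Fintype.ofFinite (segmentsOf P)
  have hbound : cutBound P.card = P.card := by unfold cutBound; split_ifs <;> omega
  refine SimpleGraph.exists_isHamiltonianCycle_of_indep_le_cut P.card
    (exists_isCycleList hP (by omega)) (fun I hI => ?_) fun A B S hA hB hcover hAB => ?_
  · refine le_trans (Finset.card_le_card_of_surjOn (t := I.image Subtype.val)
      (s := (pairs P).filter fun e => ∃ v ∈ I, seg e = v) seg ?_ |>.trans' ?_)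
      (card_le_of_pairwise_intersecting hP (Finset.filter_subset _ _) ?_)
    · intro s hs
      obtain ⟨v, hv, rfl⟩ := Finset.mem_image.1 (Finset.mem_coe.1 hs)
      obtain ⟨e, he, hev⟩ := exists_seg_eq v
      exact ⟨e, Finset.mem_coe.2 (Finset.mem_filter.2 ⟨he, v, hv, hev⟩), hev⟩
    · rw [Finset.card_image_of_injective _ Subtype.val_injective]
    · intro e he f hf
      obtain ⟨v, hv, hev⟩ := (Finset.mem_filter.1 he).2
      obtain ⟨w, hw, hfw⟩ := (Finset.mem_filter.1 hf).2
      rw [hev, hfw]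
      exact hI v hv w hw
  · have hex : ∀ X : Set (segmentsOf P), X.Nonempty →
        ∃ e ∈ pairs P, e ∈ {e | ∃ v ∈ X, seg e = v} := by
      rintro X ⟨v, hv⟩
      obtain ⟨e, he, hev⟩ := exists_seg_eq v
      exact ⟨e, he, v, hv, hev⟩
    have h := cutBound_le_card_uncolored (B := {e | ∃ v ∈ A, seg e = v})
      (R := {e | ∃ v ∈ B, seg e = v}) (by
        rintro b ⟨v, hv, hbv⟩ r ⟨w, hw, hrw⟩
        rw [hbv, hrw]
        exact hAB v hv w hw) P.card P rfl hP (hex A hA) (hex B hB)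
    rw [hbound] at h
    -- An uncoloured pair has its segment in neither `A` nor `B`, hence in `S`, and distinct pairs
    -- give distinct segments.
    refine h.trans ((Finset.card_le_card_of_injOn (t := S.image Subtype.val) seg ?_
      ((seg_injOn hP).mono ?_)).trans Finset.card_image_le)
    · intro e he
      obtain ⟨heP, heD⟩ := mem_uncolored.1 (Finset.mem_coe.1 he)
      rw [Finset.mem_coe, Finset.mem_image]
      refine ⟨⟨seg e, seg_mem_segmentsOf heP⟩, ?_, rfl⟩
      rcases hcover ⟨seg e, seg_mem_segmentsOf heP⟩ with h1 | h1 | h1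
      · exact absurd (Or.inl ⟨_, h1, rfl⟩) heD
      · exact absurd (Or.inr ⟨_, h1, rfl⟩) heD
      · exact h1
    · exact fun e he => (mem_uncolored.1 (Finset.mem_coe.1 he)).1
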